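/- Let $R$ be a Noetherian commutative ring with identity, let $n\ge 0$ be an integer and let $X_1,\dots,X_n$ be indeterminates over $R$. A Noetherian local ring is called regular if the minimal number of generators of its maximal ideal equals its Krull dimension, and a Noetherian ring is called regular if its localizations at all prime ideals are regular local rings. For an ideal $p$ of $R$, write $p[X_1,\dots,X_n]$ for its extension to $R[X_1,\dots,X_n]$. (a) Let $S$ be a multiplicative subset of $R[X_1,\dots,X_n]$. Then $S^{-1}R[X_1,\dots,X_n]$ is regular if and only if $R_p$ is regular for every prime ideal $p$ of $R$ such that $p[X_1,\dots,X_n]\cap S=\emptyset$. (b) In particular, $R(X_1,\dots,X_n)$ is regular if and only if $R\langle X_1,\dots,X_n\rangle$ is regular, if and only if $R[X_1,\dots,X_n]$ is regular, if and only if $R$ is regular. Here the Nagata ring $R(X_1,\dots,X_n)$ is the localization of $R[X_1,\dots,X_n]$ at the multiplicative set of polynomials whose coefficients generate the unit ideal of $R$. For any commutative ring $A$, $A\langle X\rangle$ is the localization of $A[X]$ at the multiplicative set of monic polynomials, and the Serre conjecture ring $R\langle X_1,\dots,X_n\rangle$ is defined recursively by $R\langle X_1,\dots,X_n\rangle:=R\langle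 X_1,\dots,X_{n-1}\rangle\langle X_n\rangle$ for $n\ge 1$, starting from $R$ itself for $n=0$. -/

import Mathlib

universe u

/-- The multiplicative set of `R[X₁, …, Xₙ]` consisting of the polynomials whose coefficients
generate the unit ideal of `R`. -/
def nagataSubmonoid (R : Type u) [CommRing R] (n : ℕ) : Submonoid (MvPolynomial (Fin n) R) where
  carrier := {f | Ideal.span (Set.range fun m => f.coeff m) = ⊤}
  one_mem' := by
    refine (Ideal.eq_top_iff_one _).2 (Ideal.subset_span ⟨0, ?_⟩)
    simp
  mul_mem' := by
    intro f g hf hg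
    by_contra h
    obtain ⟨M, hM, hle⟩ := Ideal.exists_le_maximal _ h
    have key : ∀ q : MvPolynomial (Fin n) R,
        MvPolynomial.map (Ideal.Quotient.mk M) q = 0 →
          Ideal.span (Set.range fun m => q.coeff m) ≤ M := by
      intro q hq
      rw [Ideal.span_le]
      rintro _ ⟨m, rfl⟩
      have := congrArg (MvPolynomial.coeff m) hq
      rw [MvPolynomial.coeff_map, MvPolynomial.coeff_zero] at this
      exact Ideal.Quotient.eq_zero_iff_mem.1 this
    have h0 : MvPolynomial.map (Ideal.Quotient.mk M) (f * g) = 0 := by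
      ext m
      rw [MvPolynomial.coeff_map, MvPolynomial.coeff_zero]
      exact Ideal.Quotient.eq_zero_iff_mem.2 (hle (Ideal.subset_span ⟨m, rfl⟩))
    rw [map_mul] at h0
    rcases mul_eq_zero.1 h0 with h1 | h1
    · exact hM.ne_top (top_le_iff.1 (hf.symm.le.trans (key f h1)))
    · exact hM.ne_top (top_le_iff.1 (hg.symm.le.trans (key g h1)))

/-- The Nagata ring `R(X₁, …, Xₙ)`. -/
abbrev NagataRing (R : Type u) [CommRing R] (n : ℕ) : Type u :=
  Localization (nagataSubmonoid R n)

/-- The multiplicative set of monic polynomials of `R[X]`. -/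
def monicPolynomials (R : Type u) [CommRing R] : Submonoid (Polynomial R) where
  carrier := {f | f.Monic}
  one_mem' := Polynomial.monic_one
  mul_mem' := fun hf hg => Polynomial.Monic.mul hf hg

/-- The rings `R⟨X₁, …, Xₙ⟩`, by recursion on `n`:
`R⟨X₁, …, Xₙ₊₁⟩` is the localization of `R⟨X₁, …, Xₙ⟩[Xₙ₊₁]` at its monic polynomials. The values
are bundled commutative rings so that the ring structure is carried along the recursion. -/
noncomputable def serreConjectureCommRing (R : Type u) [CommRing R] : ℕ → CommRingCat.{u}
  | 0 => CommRingCat.of R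
  | n + 1 => CommRingCat.of (Localization (monicPolynomials (serreConjectureCommRing R n)))

/-- The Serre conjecture ring `R⟨X₁, …, Xₙ⟩`. -/
abbrev SerreConjectureRing (R : Type u) [CommRing R] (n : ℕ) : Type u :=
  serreConjectureCommRing R n

open IsLocalRing TensorProduct

/-! Write `B` for the polynomial ring over `A`. A prime `p` extends to a prime `pB` contracting to
`p`, and `A_p → B_{pB}` is flat and carries the maximal ideal onto a generating set of the maximal
ideal. So both rings have the same dimension and the same number of generators of the maximal ideal,
and regularity descends. It ascends from `A_q` to `B_Q` whenever `Q` contracts to `q`; since `qB ⊆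
Q`, if `Q` misses `S` then so does `qB`. This gives (a). For (b), the Nagata and monic sets miss
every `pB`, and the Serre ring follows by iterating the one-variable case. -/

theorem Ideal.map_C_eq_ker_map_quotient {σ A : Type*} [CommRing A] (p : Ideal A) :
    p.map (MvPolynomial.C (σ := σ)) =
      RingHom.ker (MvPolynomial.map (σ := σ) (Ideal.Quotient.mk p)) := by
  rw [MvPolynomial.ker_map, Ideal.mk_ker]

/-- The kernel of a map into the domain `(A/p)[X]` is prime. -/
theorem Ideal.isPrime_map_mvPolynomial_C {σ A : Type*} [CommRing A] (p : Ideal A) [p.IsPrime] :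
    (p.map (MvPolynomial.C (σ := σ))).IsPrime := by
  rw [p.map_C_eq_ker_map_quotient]
  exact RingHom.ker_isPrime _

theorem Ideal.comap_map_mvPolynomial_C {σ A : Type*} [CommRing A] (p : Ideal A) :
    (p.map (MvPolynomial.C (σ := σ))).comap MvPolynomial.C = p := by
  rw [p.map_C_eq_ker_map_quotient]
  ext x
  simp [RingHom.mem_ker, Ideal.Quotient.eq_zero_iff_mem]

theorem Ideal.comap_map_polynomial_C {A : Type*} [CommRing A] (p : Ideal A) :
    (p.map (Polynomial.C : A →+* Polynomial A)).comap Polynomial.C = p := by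
  ext x
  rw [Ideal.mem_comap, Ideal.mem_map_C_iff]
  refine ⟨fun h => by simpa using h 0, fun h n => ?_⟩
  rw [Polynomial.coeff_C]
  split_ifs
  exacts [h, p.zero_mem]

/-! ### Descent of regularity -/

/-- Along a flat extension of Noetherian local rings in which the maximal ideal extends to the
maximal ideal, the minimal number of generators of the maximal ideal does not change. -/
theorem IsLocalRing.spanFinrank_maximalIdeal_eq_of_flat {A B : Type*} [CommRing A] [CommRing B]
    [IsLocalRing A] [IsLocalRing B] [IsNoetherianRing A] [IsNoetherianRing B] [Algebra A B]
    [Module.Flat A B] [IsLocalHom (algebraMap A B)]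
    (h : (maximalIdeal A).map (algebraMap A B) = maximalIdeal B) :
    (maximalIdeal B).spanFinrank = (maximalIdeal A).spanFinrank := by
  -- Multiplication: injective by flatness, with image the extended ideal, so the maximal ideal of
  -- `B` is a base change of that of `A`.
  let f : B ⊗[A] maximalIdeal A →ₗ[B] B :=
    LinearMap.liftBaseChange B
      ((Algebra.linearMap A B).comp (maximalIdeal A).subtype)
  have hf : Function.Injective f := by
    have key := Module.Flat.lTensor_preserves_injective_linearMap (M := B)
      (maximalIdeal A).subtype (maximalIdeal A).injective_subtype
    have hfe : ⇑f = (TensorProduct.rid A B) ∘ ((maximalIdeal A).subtype.lTensor B) := by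
      have : f.restrictScalars A =
          (TensorProduct.rid A B).toLinearMap ∘ₗ ((maximalIdeal A).subtype.lTensor B) := by
        ext x
        simp [f, Algebra.smul_def, mul_comm]
      exact congrArg DFunLike.coe this
    rw [hfe]
    exact (TensorProduct.rid A B).injective.comp key
  have hr : LinearMap.range f = maximalIdeal B := by
    rw [← h]
    refine le_antisymm ?_ ?_
    · rintro - ⟨x, rfl⟩
      induction x with
      | zero => simp
      | add _ _ h₁ h₂ => rw [map_add]; exact Ideal.add_mem _ h₁ h₂
      | tmul s x =>
        simpa [f] using Ideal.mul_mem_left _ s (Ideal.mem_map_of_mem (algebraMap A B) x.2)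
    · refine Ideal.map_le_iff_le_comap.2 fun x hx => ⟨1 ⊗ₜ ⟨x, hx⟩, ?_⟩
      simp [f]
  let e : B ⊗[A] maximalIdeal A ≃ₗ[B] maximalIdeal B :=
    (LinearEquiv.ofInjective f hf).trans (LinearEquiv.ofEq _ _ hr)
  -- By Nakayama, both numbers are dimensions over residue fields; extending scalars to
  -- `ResidueField B` makes them comparable.
  rw [← TensorProduct.spanFinrank_top_eq_of_residueField (maximalIdeal B)
      (IsNoetherian.noetherian _),
    ← TensorProduct.spanFinrank_top_eq_of_residueField (maximalIdeal A)
      (IsNoetherian.noetherian _),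
    ← Module.finrank_eq_spanFinrank_of_free, ← Module.finrank_eq_spanFinrank_of_free,
    ← Module.finrank_baseChange (R := ResidueField B) (S := ResidueField A)]
  let e₁ : ResidueField B ⊗[B] maximalIdeal B ≃ₗ[ResidueField B]
      ResidueField B ⊗[B] (B ⊗[A] maximalIdeal A) :=
    AlgebraTensorModule.congr (LinearEquiv.refl _ _) e.symm
  let e₂ := AlgebraTensorModule.cancelBaseChange A B (ResidueField B) (ResidueField B)
    (maximalIdeal A)
  let e₃ := AlgebraTensorModule.cancelBaseChange A (ResidueField A) (ResidueField B)
    (ResidueField B) (maximalIdeal A)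
  exact (e₁.trans (e₂.trans e₃.symm)).finrank_eq

/-- Descent of regularity along a flat extension at a prime that extends to a prime over it. -/
theorem IsRegularLocalRing.localization_of_flat {A B : Type*} [CommRing A] [CommRing B]
    [IsNoetherianRing A] [IsNoetherianRing B] [Algebra A B] [Module.Flat A B]
    (p : Ideal A) [p.IsPrime] (P : Ideal B) [P.IsPrime] (hP : P = p.map (algebraMap A B))
    (hp : P.comap (algebraMap A B) = p) [IsRegularLocalRing (Localization.AtPrime P)] :
    IsRegularLocalRing (Localization.AtPrime p) := by
  have : P.LiesOver p := ⟨hp.symm⟩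
  let := Localization.AtPrime.algebraOfLiesOver p P
  have : IsLocalHom (algebraMap (Localization.AtPrime p) (Localization.AtPrime P)) := by
    rw [RingHom.algebraMap_toAlgebra]
    exact Localization.isLocalHom_localRingHom p P (algebraMap A B) Ideal.LiesOver.over
  have hm : (maximalIdeal (Localization.AtPrime p)).map
      (algebraMap (Localization.AtPrime p) (Localization.AtPrime P)) =
      maximalIdeal (Localization.AtPrime P) := by
    rw [← Localization.AtPrime.map_eq_maximalIdeal, ← Localization.AtPrime.map_eq_maximalIdeal,
      Ideal.map_map, ← IsScalarTower.algebraMap_eq, IsScalarTower.algebraMap_eq A B,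
      ← Ideal.map_map, ← hP]
  -- Flatness gives going-down, and the fibre term of the height formula vanishes because `P` is
  -- exactly the extension of `p`.
  have ht : P.height = p.height := by
    rw [Ideal.height_eq_height_add_of_liesOver_of_hasGoingDown p P, ← hP, Ideal.map_quotient_self]
    simp
  apply IsRegularLocalRing.of_spanFinrank_maximalIdeal_le
  rw [← IsLocalRing.spanFinrank_maximalIdeal_eq_of_flat hm,
    IsRegularLocalRing.spanFinrank_maximalIdeal,
    IsLocalization.AtPrime.ringKrullDim_eq_height P,
    IsLocalization.AtPrime.ringKrullDim_eq_height p,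
    ht]

/-! ### Ascent of regularity to polynomial rings -/

/-- Transport of regularity of a local ring along a ring isomorphism. -/
theorem IsRegularLocalRing.localization_of_ringEquiv {A B : Type*} [CommRing A] [CommRing B]
    (e : A ≃+* B) (P : Ideal B) [P.IsPrime] (Q : Ideal A) [Q.IsPrime] (hQ : Q = P.comap e)
    [IsRegularLocalRing (Localization.AtPrime Q)] :
    IsRegularLocalRing (Localization.AtPrime P) := by
  subst hQ
  exact IsRegularLocalRing.of_ringEquiv <| IsLocalization.ringEquivOfRingEquiv
    (Localization.AtPrime (P.comap e)) (Localization.AtPrime P) e (e.map_primeCompl_comap_eq P)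

open Polynomial in
/-- If `Q` is a prime of `A[X]` over `p` and `A_p` is regular, then so is `A[X]_Q`. -/
theorem Polynomial.isRegularLocalRing_localization_of_comap {A : Type*} [CommRing A]
    (Q : Ideal A[X]) [Q.IsPrime] (q : Ideal A) [q.IsPrime] (hq : Q.comap C = q)
    [IsRegularLocalRing (Localization.AtPrime q)] :
    IsRegularLocalRing (Localization.AtPrime Q) := by
  -- Inverting `A \ q` first reduces to a prime of `A_q[X]` lying over the maximal ideal, without
  -- changing the local ring at `Q`.
  let S := (Localization.AtPrime q)[X]
  let pc := Submonoid.map Polynomial.C.toMonoidHom q.primeCompl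
  let : Algebra A[X] S := algebra A (Localization.AtPrime q)
  have : IsLocalization pc S := Polynomial.isLocalization _ _
  let QS := Q.map (algebraMap A[X] S)
  have disj : Disjoint (pc : Set A[X]) (Q : Set A[X]) := by
    subst hq
    simpa [pc] using! Set.disjoint_image_left.mpr
      (Set.disjoint_compl_left_iff_subset.mpr (fun _ a ↦ a))
  have : QS.IsPrime := IsLocalization.isPrime_of_isPrime_disjoint pc _ _ ‹_› disj
  have : IsLocalization.AtPrime (Localization.AtPrime QS) Q := by
    convert IsLocalization.isLocalization_isLocalization_atPrime_isLocalization pc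
      (Localization.AtPrime QS) QS
    exact (IsLocalization.under_map_of_isPrime_disjoint pc _ ‹_› disj).symm
  -- Ideals of `A_q` are determined by their contractions to `A`; here both contract to `q`.
  have eq : Ideal.comap C QS = maximalIdeal (Localization.AtPrime q) := by
    rw [← IsLocalization.map_under q.primeCompl _ (Ideal.comap C QS),
      ← IsLocalization.map_under q.primeCompl _ (maximalIdeal (Localization.AtPrime q))]
    simp only [Ideal.comap_comap, S, QS]
    rw [← Polynomial.algebraMap_eq (R := Localization.AtPrime q),
      ← IsScalarTower.algebraMap_eq A (Localization.AtPrime q) (Localization.AtPrime q)[X],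
      IsScalarTower.algebraMap_eq A A[X] (Localization.AtPrime q)[X], ← Ideal.comap_comap,
      ← Ideal.under_def A[X], IsLocalization.under_map_of_isPrime_disjoint pc _ ‹_› disj]
    simp [hq, IsLocalization.AtPrime.under_maximalIdeal (Localization.AtPrime q) q]
  have := isRegularLocalRing_localization_atPrime_of_comap_eq_maximalIdeal _ QS eq
  exact IsRegularLocalRing.of_ringEquiv (R := Localization.AtPrime QS)
    (IsLocalization.algEquiv Q.primeCompl
      (Localization.AtPrime QS) (Localization.AtPrime Q)).toRingEquiv

theorem MvPolynomial.isRegularLocalRing_localization_of_comap {A : Type*} [CommRing A] (n : ℕ)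
    (Q : Ideal (MvPolynomial (Fin n) A)) [Q.IsPrime] (q : Ideal A) [q.IsPrime]
    (hq : Q.comap C = q) [IsRegularLocalRing (Localization.AtPrime q)] :
    IsRegularLocalRing (Localization.AtPrime Q) := by
  induction n with
  | zero =>
    refine IsRegularLocalRing.localization_of_ringEquiv (isEmptyRingEquiv A (Fin 0)).symm Q q ?_
    rw [← hq]
    rfl
  | succ n ih =>
    let e := (finSuccEquiv A n).toRingEquiv
    let Q' := Q.comap (e.symm : Polynomial (MvPolynomial (Fin n) A) →+* _)
    have hQ' : (Q'.comap Polynomial.C).comap C = q := by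
      rw [← hq, ← finSuccEquiv_comp_C_eq_C n]
      rfl
    have := ih (Q'.comap Polynomial.C) hQ'
    have := Polynomial.isRegularLocalRing_localization_of_comap Q' _ rfl
    exact IsRegularLocalRing.localization_of_ringEquiv e.symm Q Q' rfl

/-! ### Regularity of localizations -/

/-- A localization is regular iff the local rings at the primes that survive in it are. -/
theorem isRegularRing_localization_iff {B : Type*} [CommRing B] [IsNoetherianRing B]
    (S : Submonoid B) :
    IsRegularRing (Localization S) ↔ ∀ (Q : Ideal B) [Q.IsPrime], Disjoint (S : Set B) Q →
      IsRegularLocalRing (Localization.AtPrime Q) := by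
  have : IsNoetherianRing (Localization S) := IsLocalization.isNoetherianRing S _ ‹_›
  rw [isRegularRing_iff]
  refine ⟨fun h Q hQ hd => ?_, fun h Q hQ => ?_⟩
  · have := IsLocalization.isPrime_of_isPrime_disjoint S (Localization S) Q hQ hd
    have hu := IsLocalization.under_map_of_isPrime_disjoint S (Localization S) hQ hd
    have := h (Q.map (algebraMap B (Localization S)))
    have := IsRegularLocalRing.of_ringEquiv
      (IsLocalization.localizationLocalizationAtPrimeIsoLocalization S
        (Q.map (algebraMap B (Localization S)))).symm.toRingEquiv
    exact IsRegularLocalRing.localization_of_ringEquiv (RingEquiv.refl B) Q _ hu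
  · have := h (Q.comap (algebraMap B (Localization S)))
      (((IsLocalization.isPrime_iff_isPrime_disjoint S _ Q).1 hQ).2)
    exact IsRegularLocalRing.of_ringEquiv
      (IsLocalization.localizationLocalizationAtPrimeIsoLocalization S Q).toRingEquiv

/-- Regularity of the localizations of a flat extension in which primes extend to primes lying over
them and along which regularity of the local rings ascends. -/
theorem isRegularRing_localization_iff_of_flat {A B : Type*} [CommRing A] [CommRing B]
    [IsNoetherianRing A] [IsNoetherianRing B] [Algebra A B] [Module.Flat A B]
    (hprime : ∀ (p : Ideal A) [p.IsPrime], (p.map (algebraMap A B)).IsPrime)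
    (hcomap : ∀ p : Ideal A, (p.map (algebraMap A B)).comap (algebraMap A B) = p)
    (hasc : ∀ (Q : Ideal B) [Q.IsPrime] (q : Ideal A) [q.IsPrime], Q.comap (algebraMap A B) = q →
      IsRegularLocalRing (Localization.AtPrime q) → IsRegularLocalRing (Localization.AtPrime Q))
    (S : Submonoid B) :
    IsRegularRing (Localization S) ↔
      ∀ (p : Ideal A) [p.IsPrime], ((p.map (algebraMap A B) : Set B) ∩ S = ∅) →
        IsRegularLocalRing (Localization.AtPrime p) := by
  rw [isRegularRing_localization_iff]
  refine ⟨fun h p hp hd => ?_, fun h Q hQ hd => ?_⟩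
  · have := hprime p
    have := h _ (Set.disjoint_iff_inter_eq_empty.2 hd).symm
    exact IsRegularLocalRing.localization_of_flat p _ rfl (hcomap p)
  · refine hasc Q _ rfl (h _ ?_)
    exact Set.disjoint_iff_inter_eq_empty.1 (hd.symm.mono_left Ideal.map_comap_le)

theorem MvPolynomial.isRegularRing_localization_iff {A : Type*} [CommRing A] [IsNoetherianRing A]
    (n : ℕ) (S : Submonoid (MvPolynomial (Fin n) A)) :
    IsRegularRing (Localization S) ↔
      ∀ (p : Ideal A) [p.IsPrime],
        ((p.map (C (σ := Fin n)) : Set (MvPolynomial (Fin n) A)) ∩ S = ∅) →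
          IsRegularLocalRing (Localization.AtPrime p) := by
  have key := isRegularRing_localization_iff_of_flat (A := A) (B := MvPolynomial (Fin n) A)
  rw [MvPolynomial.algebraMap_eq] at key
  exact key (fun p _ => p.isPrime_map_mvPolynomial_C) (fun p => p.comap_map_mvPolynomial_C)
    (fun Q _ q _ hq _ => isRegularLocalRing_localization_of_comap n Q q hq) S

theorem Polynomial.isRegularRing_localization_iff {A : Type*} [CommRing A] [IsNoetherianRing A]
    (S : Submonoid (Polynomial A)) :
    IsRegularRing (Localization S) ↔
      ∀ (p : Ideal A) [p.IsPrime],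
        ((p.map (C : A →+* Polynomial A) : Set (Polynomial A)) ∩ S = ∅) →
          IsRegularLocalRing (Localization.AtPrime p) := by
  have key := isRegularRing_localization_iff_of_flat (A := A) (B := Polynomial A)
  rw [Polynomial.algebraMap_eq] at key
  exact key (fun _ _ => Ideal.isPrime_map_C_of_isPrime) (fun p => p.comap_map_polynomial_C)
    (fun Q _ q _ hq _ => isRegularLocalRing_localization_of_comap Q q hq) S

/-! ### The Nagata, polynomial and Serre conjecture rings -/

theorem isRegularRing_nagataRing_iff (R : Type u) [CommRing R] [IsNoetherianRing R] (n : ℕ) :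
    IsRegularRing (NagataRing R n) ↔ IsRegularRing R := by
  rw [MvPolynomial.isRegularRing_localization_iff, isRegularRing_iff]
  refine ⟨fun h p hp => h p ?_, fun h p _ _ => h p⟩
  rw [Set.eq_empty_iff_forall_notMem]
  rintro f ⟨hf, hS⟩
  -- All coefficients of `f` lie in `p`, yet they generate the unit ideal.
  refine hp.ne_top (top_le_iff.1 ?_)
  rw [← show Ideal.span (Set.range fun m => f.coeff m) = ⊤ from hS, Ideal.span_le]
  rintro _ ⟨m, rfl⟩
  exact MvPolynomial.mem_map_C_iff.1 hf m

theorem isRegularRing_localization_monicPolynomials_iff (R : Type u) [CommRing R]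
    [IsNoetherianRing R] :
    IsRegularRing (Localization (monicPolynomials R)) ↔ IsRegularRing R := by
  rw [Polynomial.isRegularRing_localization_iff, isRegularRing_iff]
  refine ⟨fun h p hp => h p ?_, fun h p _ _ => h p⟩
  rw [Set.eq_empty_iff_forall_notMem]
  rintro f ⟨hf, hS⟩
  -- The leading coefficient 1 would lie in `p`.
  refine hp.ne_top ((Ideal.eq_top_iff_one _).2 ?_)
  rw [← show f.leadingCoeff = 1 from hS]
  exact Ideal.mem_map_C_iff.1 hf _

theorem isRegularRing_mvPolynomial_iff (R : Type u) [CommRing R] [IsNoetherianRing R] (n : ℕ) :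
    IsRegularRing (MvPolynomial (Fin n) R) ↔ IsRegularRing R := by
  refine ⟨fun h => isRegularRing_iff.2 fun p hp => ?_, fun h => inferInstance⟩
  have := p.isPrime_map_mvPolynomial_C (σ := Fin n)
  have := isRegularRing_iff.1 h (p.map (MvPolynomial.C (σ := Fin n)))
  exact IsRegularLocalRing.localization_of_flat p (p.map (MvPolynomial.C (σ := Fin n))) rfl
    p.comap_map_mvPolynomial_C

theorem isNoetherianRing_serreConjectureRing (R : Type u) [CommRing R] [IsNoetherianRing R]
    (n : ℕ) : IsNoetherianRing (SerreConjectureRing R n) := by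
  induction n with
  | zero => assumption
  | succ n _ =>
    exact IsLocalization.isNoetherianRing (monicPolynomials (serreConjectureCommRing R n))
      (Localization (monicPolynomials (serreConjectureCommRing R n))) inferInstance

theorem isRegularRing_serreConjectureRing_iff (R : Type u) [CommRing R] [IsNoetherianRing R]
    (n : ℕ) : IsRegularRing (SerreConjectureRing R n) ↔ IsRegularRing R := by
  induction n with
  | zero => rfl
  | succ n ih =>
    have := isNoetherianRing_serreConjectureRing R n
    exact (isRegularRing_localization_monicPolynomials_iff (serreConjectureCommRing R n)).trans ih

theorem corollary3p3 (R : Type u) [CommRing R] [IsNoetherianRing R] (n : ℕ) :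
    (∀ S : Submonoid (MvPolynomial (Fin n) R),
      IsRegularRing (Localization S) ↔
        ∀ (p : Ideal R) [p.IsPrime],
          ((p.map (MvPolynomial.C (σ := Fin n)) : Set (MvPolynomial (Fin n) R)) ∩ S = ∅) →
            IsRegularLocalRing (Localization.AtPrime p)) ∧
    ((IsRegularRing (NagataRing R n) ↔ IsRegularRing (SerreConjectureRing R n)) ∧
      (IsRegularRing (SerreConjectureRing R n) ↔ IsRegularRing (MvPolynomial (Fin n) R)) ∧
      (IsRegularRing (MvPolynomial (Fin n) R) ↔ IsRegularRing R)) := by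
  rw [isRegularRing_nagataRing_iff, isRegularRing_serreConjectureRing_iff,
    isRegularRing_mvPolynomial_iff]
  exact ⟨MvPolynomial.isRegularRing_localization_iff n, Iff.rfl, Iff.rfl, Iff.rfl⟩
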